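/- Definitions. A tree is a set of finite sequences that contains the empty sequence and is closed under initial segments; it is well-founded if no infinite sequence has all its finite initial segments in the tree. The order type $|T|$ of a well-founded tree $T$ is the ordinal $|\langle\rangle|$ of its root, where $|\sigma|$ is the supremum of $|\sigma'|+1$ over all immediate extensions $\sigma'\in T$ of $\sigma$; if $T$ is not well-founded, $|T|=\infty$. A recursive ordinal is an ordinal of the form $|T|$ for a recursive well-founded tree $T$ of finite sequences of natural numbers. A set system $\mathcal L\subseteq P(X)$ has finite elasticity if there are no infinite sequences $t_0,t_1,\ldots\in X$ and $L_1,L_2,\ldots\in\mathcal L$ with $\{t_0,\ldots,t_{i-1}\}\subseteq L_i\not\ni t_i$ for all $i\ge 1$. Its dimension $\dim\mathcal L$ is the order type of the tree of all finite sequences $\langle\langle t_0,L_1\rangle,\ldots,\langle t_{m-1},L_m\rangle\rangle$ ($m\ge 0$) with $\{t_0,\ldots,t_{i-1}\}\subseteq L_i\in\mathcal L$ for $1\le i\le m$ and $t_j\notin L_j$ for $1\le j\le m-1$. An indexed family of recursive languages over a set $X$ consists of sets $I,J\subseteq\mathbb N$, a bijection $\nu:J\to X$ and a recursive function $\gamma:I\times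 J\to\{0,1\}$ (that is, the partial function on $\mathbb N\times\mathbb N$ with domain $I\times J$ and values $\gamma(i,j)$ is partial recursive). Its languages are $\mathcal L^i=\{\nu(j) : j\in J,\ \gamma(i,j)=1\}$ for $i\in I$; it is without repetition if $\mathcal L^i\neq\mathcal L^{i'}$ whenever $i\ne i'$. Its elasticity and dimension are those of the set system $\{\mathcal L^i : i\in I\}$. Theorem. If an indexed family of recursive languages without repetition has finite elasticity, then its dimension is a recursive ordinal. Conversely, for every recursive ordinal $\alpha$ there is an indexed family of recursive languages without repetition, with recursive index sets $I$ and $J$, whose dimension is $\alpha$. -/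

import Mathlib

universe u

/-- A tree: a set of finite sequences over `A` that contains the empty sequence (its root)
and is closed under initial segments. -/
structure SeqTree (A : Type u) where
  nodes : Set (List A)
  nil_mem : [] ∈ nodes
  mem_of_prefix : ∀ {σ τ : List A}, τ ∈ nodes → σ <+: τ → σ ∈ nodes

namespace SeqTree

variable {A : Type u}

/-- No infinite sequence has all of its finite initial segments in the tree. -/
def IsWellFounded (T : SeqTree A) : Prop :=
  ¬ ∃ a : ℕ → A, ∀ n : ℕ, List.ofFn (fun i : Fin n => a i) ∈ T.nodes

/-- `T.Child τ σ`: the node `τ` is an immediate extension of the node `σ`. -/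
def Child (T : SeqTree A) (τ σ : T.nodes) : Prop :=
  ∃ a : A, (τ : List A) = (σ : List A) ++ [a]

theorem IsWellFounded.wellFounded_child {T : SeqTree A} (h : T.IsWellFounded) :
    WellFounded T.Child := by
  rw [wellFounded_iff_isEmpty_descending_chain]
  refine ⟨fun ⟨f, hf⟩ => h ?_⟩
  choose a ha using hf
  have key : ∀ n : ℕ, (f n : List A) =
      (f 0 : List A) ++ List.ofFn (fun i : Fin n => a i) := by
    intro n
    induction n with
    | zero => simp
    | succ n ih => rw [ha n, ih, List.ofFn_succ']; simp
  -- the branch through the chain: first the entries of `f 0`, then the entries `a 0, a 1, …`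
  refine ⟨fun k => if hk : k < (f 0 : List A).length then (f 0 : List A)[k]
    else a (k - (f 0 : List A).length), fun n => ?_⟩
  refine T.mem_of_prefix (f n).2 ?_
  rw [List.prefix_iff_eq_take, key n]
  apply List.ext_getElem
  · simp
  · intro i h1 h2
    simp [List.getElem_append]

open Classical in
/-- The order type of a tree: if the tree is well-founded, the ordinal `|⟨⟩|` of its root, where
`|σ|` is the supremum of `|τ| + 1` over the immediate extensions `τ` of `σ` in the tree;
otherwise `∞`, written `⊤`. -/
noncomputable def orderType (T : SeqTree A) : WithTop Ordinal.{u} :=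
  if h : T.IsWellFounded then
    (((h.wellFounded_child.apply ⟨[], T.nil_mem⟩).rank : Ordinal.{u}) : WithTop Ordinal.{u})
  else ⊤

/-- A tree of finite sequences of natural numbers is recursive if membership is decidable. -/
def IsRecursive (T : SeqTree ℕ) : Prop :=
  ComputablePred fun σ : List ℕ => σ ∈ T.nodes

end SeqTree

/-- A recursive ordinal is the order type of a recursive well-founded tree of finite sequences of
natural numbers (`Ordinal.lift` only changes the universe). -/
def IsRecursiveOrdinal (α : Ordinal.{u}) : Prop :=
  ∃ (T : SeqTree ℕ) (β : Ordinal.{0}), T.IsRecursive ∧ T.IsWellFounded ∧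
    T.orderType = (β : WithTop Ordinal.{0}) ∧ Ordinal.lift.{u} β = α

section SetSystem

variable {X : Type u}

/-- There are `t₀, t₁, …` in `X` and `L₁, L₂, …` in `𝓛` such that
`{t₀, …, tᵢ₋₁} ⊆ Lᵢ` and `tᵢ ∉ Lᵢ` for every `i ≥ 1` (the value `L 0` plays no role). -/
def HasInfiniteElasticity (𝓛 : Set (Set X)) : Prop :=
  ∃ (t : ℕ → X) (L : ℕ → Set X), ∀ i : ℕ, 1 ≤ i →
    L i ∈ 𝓛 ∧ (∀ k : ℕ, k < i → t k ∈ L i) ∧ t i ∉ L i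

def HasFiniteElasticity (𝓛 : Set (Set X)) : Prop :=
  ¬ HasInfiniteElasticity 𝓛

/-- The list `⟨t₀, L₁⟩, ⟨t₁, L₂⟩, …, ⟨tₘ₋₁, Lₘ⟩` is a production sequence:
`{t₀, …, tᵢ₋₁} ⊆ Lᵢ ∈ 𝓛` for `1 ≤ i ≤ m` and `tⱼ ∉ Lⱼ` for `1 ≤ j ≤ m - 1`.
The entry at position `i` of the list is `⟨tᵢ, Lᵢ₊₁⟩`. -/
def IsProductionSeq (𝓛 : Set (Set X)) (s : List (X × Set X)) : Prop :=
  (∀ (i : ℕ) (hi : i < s.length), s[i].2 ∈ 𝓛 ∧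
    ∀ (k : ℕ) (hk : k ≤ i), s[k].1 ∈ s[i].2) ∧
  ∀ (j : ℕ) (hj : j + 1 < s.length), s[j + 1].1 ∉ s[j].2

/-- The tree of the finite production sequences of a set system. -/
def productionTree (𝓛 : Set (Set X)) : SeqTree (X × Set X) where
  nodes := {s | IsProductionSeq 𝓛 s}
  nil_mem := ⟨fun i hi => absurd hi (by simp), fun j hj => absurd hj (by simp)⟩
  mem_of_prefix := by
    rintro σ _ ⟨h1, h2⟩ ⟨ρ, rfl⟩
    refine ⟨fun i hi => ?_, fun j hj => ?_⟩
    · obtain ⟨ha, hb⟩ := h1 i (by simp; omega)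
      refine ⟨by simpa [List.getElem_append, hi] using ha, fun k hk => ?_⟩
      have hk' : k < σ.length := by omega
      simpa [List.getElem_append, hi, hk'] using hb k hk
    · have hj' : j < σ.length := by omega
      have hh := h2 j (by simp; omega)
      rwa [List.getElem_append_left hj, List.getElem_append_left hj'] at hh

/-- The dimension of a set system, an ordinal or `∞`. -/
noncomputable def setSystemDim (𝓛 : Set (Set X)) : WithTop Ordinal.{u} :=
  (productionTree 𝓛).orderType

end SetSystem

/-- An indexed family of recursive languages over `X`: sets `I, J ⊆ ℕ`, a bijection `ν : J → X`
and a recursive function `γ : I × J → {0, 1}`, that is, the partial function on `ℕ × ℕ` with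
domain `I × J` and values `γ (i, j)` is partial recursive. -/
structure IFRL (X : Type u) where
  I : Set ℕ
  J : Set ℕ
  ν : J → X
  ν_bijective : Function.Bijective ν
  γ : I × J → Bool
  γ_recursive : Partrec fun p : ℕ × ℕ =>
    (⟨p.1 ∈ I ∧ p.2 ∈ J, fun h => γ (⟨p.1, h.1⟩, ⟨p.2, h.2⟩)⟩ : Part Bool)

namespace IFRL

variable {X : Type u}

/-- The `i`-th language of the family. -/
def lang (F : IFRL X) (i : F.I) : Set X :=
  {x | ∃ j : F.J, F.ν j = x ∧ F.γ (i, j) = true}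

/-- The set system formed by the languages of the family. -/
def setSystem (F : IFRL X) : Set (Set X) :=
  Set.range F.lang

def WithoutRepetition (F : IFRL X) : Prop :=
  ∀ i j : F.I, i ≠ j → F.lang i ≠ F.lang j

/-- The dimension of the family is the dimension of its set system. -/
noncomputable def dim (F : IFRL X) : WithTop Ordinal.{u} :=
  setSystemDim F.setSystem

end IFRL

-- A map of trees that fixes the root and sends children to proper descendants cannot lower ranks,
-- and it pulls well-foundedness back (`lift_rootRank_le`, `IsWellFounded.of_map`). Each equality of
-- order types below comes from two such maps in opposite directions.
--
-- For the first half, suppose that there is a word and a language. The domain of `γ` is then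
-- nonempty and projects onto `I` and `J`, so both are ranges of computable functions. Hence the
-- pairs of a word and a language can be named by natural numbers, possibly repeatedly. Whether a
-- list of names spells a production sequence is settled by finitely many values of `γ`, so the tree
-- of such lists is recursive, and renaming keeps its order type (`comap_rootRank`).
--
-- For the converse, the words are the nonroot nodes of a recursive tree `T`, and the language of a
-- node consists of its nonempty initial segments. Two consecutive words of a production sequence
-- lie in a common language, so they are comparable; the later one avoids a language containing the
-- earlier one, so it properly extends it. Thus the last word descends in `T`. Conversely, a node
-- gives the sequence of its nonempty initial segments. Admitting the root as a word would raise the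
-- dimension to `|T| + 1`.

universe v

/-! ### Ranks of trees under maps. -/

namespace SeqTree

variable {A : Type u} {B : Type v}

theorem isWellFounded_of_wellFounded {T : SeqTree A} (h : WellFounded T.Child) :
    T.IsWellFounded := by
  rintro ⟨a, ha⟩
  rw [wellFounded_iff_isEmpty_descending_chain] at h
  refine h.elim ⟨fun n => ⟨_, ha n⟩, fun n => ⟨a n, ?_⟩⟩
  change List.ofFn _ = List.ofFn _ ++ [a n]
  rw [List.ofFn_succ', List.concat_eq_append]
  simp

theorem IsWellFounded.of_map {T : SeqTree A} {S : SeqTree B} (hS : S.IsWellFounded)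
    (f : T.nodes → S.nodes)
    (hf : ∀ x y, T.Child x y → Relation.TransGen S.Child (f x) (f y)) : T.IsWellFounded :=
  isWellFounded_of_wellFounded <|
    Subrelation.wf (fun {x y} h => hf x y h) (InvImage.wf f hS.wellFounded_child.transGen)

/-- The rank of the root of a well-founded tree. -/
noncomputable def IsWellFounded.rootRank {T : SeqTree A} (h : T.IsWellFounded) : Ordinal.{u} :=
  (h.wellFounded_child.apply ⟨[], T.nil_mem⟩).rank

theorem IsWellFounded.orderType_eq {T : SeqTree A} (h : T.IsWellFounded) :
    T.orderType = (h.rootRank : WithTop Ordinal.{u}) := by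
  rw [orderType, dif_pos h]; rfl

end SeqTree

theorem WellFounded.rank_lt_of_transGen {A : Type u} {r : A → A → Prop} (hr : WellFounded r)
    {x y : A} (h : Relation.TransGen r x y) : (hr.apply x).rank < (hr.apply y).rank := by
  induction h with
  | single h => exact (hr.apply _).rank_lt_of_rel h
  | tail _ h ih => exact ih.trans ((hr.apply _).rank_lt_of_rel h)

/-- If the rank of `f x` were smaller, it would be at most the rank of some `y` below `x`, hence by
induction at most that of `f y`, although `f y` lies below `f x`. The bound is first brought down to
the universe of `A`, where the supremum defining the rank of `x` is taken. -/
theorem WellFounded.lift_rank_le_of_map {A : Type u} {B : Type v} {r : A → A → Prop}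
    {s : B → B → Prop} (hr : WellFounded r) (hs : WellFounded s) (f : A → B)
    (hf : ∀ x y, r x y → Relation.TransGen s (f x) (f y)) (x : A) :
    Ordinal.lift.{v} ((hr.apply x).rank) ≤ Ordinal.lift.{u} ((hs.apply (f x)).rank) := by
  induction x using hr.induction with
  | _ x ih =>
    by_contra! hlt
    obtain ⟨c, hcx, hc⟩ := Ordinal.lt_lift_iff.1 hlt
    rw [(hr.apply x).rank_eq] at hcx
    obtain ⟨⟨y, hy⟩, hcy⟩ := (Ordinal.lt_iSup_iff).1 hcx
    have h1 := Ordinal.lift_le.{v}.2 (Order.lt_succ_iff.1 hcy)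
    rw [hc] at h1
    exact absurd (Ordinal.lift_lt.{u}.2 (hs.rank_lt_of_transGen (hf y x hy)))
      (not_lt.2 (h1.trans (ih y hy)))

namespace SeqTree

variable {A : Type u} {B : Type v}

theorem lift_rootRank_le {T : SeqTree A} {S : SeqTree B} (hT : T.IsWellFounded)
    (hS : S.IsWellFounded) (f : T.nodes → S.nodes)
    (hf : ∀ x y, T.Child x y → Relation.TransGen S.Child (f x) (f y))
    (hnil : (f ⟨[], T.nil_mem⟩ : List B) = []) :
    Ordinal.lift.{v} hT.rootRank ≤ Ordinal.lift.{u} hS.rootRank := by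
  have h := hT.wellFounded_child.lift_rank_le_of_map hS.wellFounded_child f hf ⟨[], T.nil_mem⟩
  rwa [show f ⟨[], T.nil_mem⟩ = ⟨[], S.nil_mem⟩ from Subtype.ext hnil] at h

theorem transGen_child_of_prefix {T : SeqTree A} (x y : T.nodes)
    (h : (y : List A) <+: (x : List A)) (hne : (y : List A) ≠ x) :
    Relation.TransGen T.Child x y := by
  obtain ⟨x, hx⟩ := x
  induction x using List.reverseRecOn with
  | nil => exact absurd (List.prefix_nil.1 h) hne
  | append_singleton l a ih =>
    have hl : l ∈ T.nodes := T.mem_of_prefix hx (List.prefix_append _ _)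
    have hc : T.Child ⟨l ++ [a], hx⟩ ⟨l, hl⟩ := ⟨a, rfl⟩
    rcases List.prefix_concat_iff.1 h with h | h
    · exact absurd h hne
    · by_cases hyl : (y : List A) = l
      · obtain rfl : y = ⟨l, hl⟩ := Subtype.ext hyl
        exact .single hc
      · exact .head hc (ih hl h hyl)

end SeqTree

/-! ### Decidable and recursively enumerable predicates. -/

namespace ComputablePred

theorem forall_lt {α : Type*} [Primcodable α] {p : α → ℕ → Prop}
    (hp : ComputablePred fun q : α × ℕ => p q.1 q.2) :
    ComputablePred fun q : α × ℕ => ∀ k < q.2, p q.1 k := by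
  classical
  obtain ⟨f, hf, hpf⟩ := computable_iff.1 hp
  have hpf' : ∀ a k, p a k ↔ f (a, k) = true := fun a k => iff_of_eq (congrFun hpf (a, k))
  refine (computable_iff (α := α × ℕ)).2 ⟨fun q : α × ℕ =>
    Nat.rec (motive := fun _ => Bool) true (fun k b => f (q.1, k) && b) q.2, ?_, ?_⟩
  · have hstep : Computable₂ fun (q : α × ℕ) (r : ℕ × Bool) => f (q.1, r.1) && r.2 :=
      Primrec.and.to_comp.comp
        (hf.comp ((Computable.fst.comp Computable.fst).pair (Computable.fst.comp Computable.snd)))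
        (Computable.snd.comp Computable.snd)
    exact Computable.nat_rec Computable.snd (Computable.const true) hstep
  · funext ⟨a, n⟩
    simp only [eq_iff_iff]
    induction n with
    | zero => simp
    | succ n ih =>
      simp only [Bool.and_eq_true, ← hpf', ← ih, Nat.lt_succ_iff_lt_or_eq]
      grind

theorem comp {α β : Type*} [Primcodable α] [Primcodable β] {p : β → Prop}
    (hp : ComputablePred p) {f : α → β} (hf : Computable f) :
    ComputablePred fun a => p (f a) := by
  obtain ⟨g, hg, rfl⟩ := computable_iff.1 hp
  exact computable_iff.2 ⟨_, hg.comp hf, rfl⟩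

theorem and {α : Type*} [Primcodable α] {p q : α → Prop}
    (hp : ComputablePred p) (hq : ComputablePred q) : ComputablePred fun a => p a ∧ q a := by
  obtain ⟨f, hf, rfl⟩ := computable_iff.1 hp
  obtain ⟨g, hg, rfl⟩ := computable_iff.1 hq
  exact computable_iff.2 ⟨fun a => f a && g a, Primrec.and.to_comp.comp hf hg, by simp⟩

end ComputablePred

/-- The input codes a step bound and a candidate; the candidate is returned if the semi-decision
procedure halts on it within the bound, and the known element `a` otherwise. -/
theorem REPred.exists_computable_range {p : ℕ → Prop} (hp : REPred p) {a : ℕ} (ha : p a) :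
    ∃ f : ℕ → ℕ, Computable f ∧ Set.range f = {n | p n} := by
  obtain ⟨c, hc⟩ := Nat.Partrec.Code.exists_code.1
    (Partrec.nat_iff.1 (hp.map (Computable.const 0).to₂))
  have hdom : ∀ n, p n ↔ ∃ k, (Nat.Partrec.Code.evaln k c n).isSome := by
    intro n
    have h1 : p n ↔ ∃ x, x ∈ c.eval n := by rw [hc]; simp
    rw [h1]
    simp only [Nat.Partrec.Code.evaln_complete, Option.isSome_iff_exists, Option.mem_def]
    exact exists_comm
  refine ⟨fun n => cond (Nat.Partrec.Code.evaln n.unpair.1 c n.unpair.2).isSome n.unpair.2 a,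
    ?_, ?_⟩
  · have h1 : Computable fun n : ℕ => n.unpair.1 := Computable.fst.comp Computable.unpair
    have h2 : Computable fun n : ℕ => n.unpair.2 := Computable.snd.comp Computable.unpair
    refine Computable.cond (Primrec.option_isSome.to_comp.comp ?_) h2 (Computable.const a)
    exact Nat.Partrec.Code.primrec_evaln.to_comp.comp ((h1.pair (Computable.const c)).pair h2)
  · ext m
    constructor
    · rintro ⟨n, rfl⟩
      rcases h : (Nat.Partrec.Code.evaln n.unpair.1 c n.unpair.2).isSome
      · simpa [h] using ha
      · simpa [h] using (hdom _).2 ⟨_, h⟩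
    · intro hm
      obtain ⟨k, hk⟩ := (hdom m).1 hm
      exact ⟨Nat.pair k m, by simp [hk]⟩

/-! ### The dimension of an indexed family is a recursive ordinal. -/

section IndexTree

variable {X : Type u}

theorem HasFiniteElasticity.isWellFounded {𝓛 : Set (Set X)} (h : HasFiniteElasticity 𝓛) :
    (productionTree 𝓛).IsWellFounded := by
  rintro ⟨a, ha⟩
  -- Entry `n - 1` of the branch carries the language with index `n`; the value at `0` is
  -- irrelevant.
  refine h ⟨fun n => (a n).1, fun n => (a (n - 1)).2, fun i hi => ?_⟩
  obtain ⟨i, rfl⟩ : ∃ k, i = k + 1 := ⟨i - 1, by omega⟩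
  obtain ⟨h1, h2⟩ := ha (i + 2)
  have h3 := h1 i (by simp)
  have h4 := h2 i (by simp)
  simp only [List.getElem_ofFn] at h3 h4
  exact ⟨h3.1, fun k hk => h3.2 k (by omega), h4⟩

theorem mem_of_mem_productionSeq {𝓛 : Set (Set X)} {s : List (X × Set X)}
    (hs : IsProductionSeq 𝓛 s) {p : X × Set X} (hp : p ∈ s) : p.2 ∈ 𝓛 := by
  obtain ⟨i, hi, rfl⟩ := List.getElem_of_mem hp
  exact (hs.1 i hi).1

/-- The preimage of a tree under a letterwise substitution. -/
def SeqTree.comap {A : Type u} {B : Type v} (φ : A → B) (T : SeqTree B) : SeqTree A where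
  nodes := {σ | σ.map φ ∈ T.nodes}
  nil_mem := T.nil_mem
  mem_of_prefix h hp := T.mem_of_prefix h (hp.map φ)

/-- Relabelling the letters of a well-founded tree does not change its order type, provided that
every letter occurring in the tree is a label. -/
theorem SeqTree.comap_rootRank {A : Type u} {B : Type v} [Nonempty A] (φ : A → B) {T : SeqTree B}
    (hφ : ∀ σ ∈ T.nodes, ∀ b ∈ σ, b ∈ Set.range φ) (hT : T.IsWellFounded) :
    ∃ h : (T.comap φ).IsWellFounded,
      Ordinal.lift.{v} h.rootRank = Ordinal.lift.{u} hT.rootRank := by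
  classical
  let f : (T.comap φ).nodes → T.nodes := fun σ => ⟨(σ : List A).map φ, σ.2⟩
  have hf : ∀ x y, (T.comap φ).Child x y → Relation.TransGen T.Child (f x) (f y) := by
    rintro x y ⟨a, ha⟩
    exact .single ⟨φ a, by simp [f, ha]⟩
  have h := hT.of_map f hf
  refine ⟨h, le_antisymm (SeqTree.lift_rootRank_le h hT f hf rfl) ?_⟩
  -- Repeated labels do no harm: choosing one label for each letter already maps `T` back.
  let s := Function.invFun φ
  have hs : ∀ σ ∈ T.nodes, (σ.map s).map φ = σ := by
    intro σ hσ
    rw [List.map_map]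
    conv_rhs => rw [← List.map_id σ]
    exact List.map_congr_left fun b hb => Function.invFun_eq (hφ σ hσ b hb)
  refine SeqTree.lift_rootRank_le hT h
    (fun σ => ⟨(σ : List B).map s, by
      change ((σ : List B).map s).map φ ∈ T.nodes
      rw [hs _ σ.2]; exact σ.2⟩) ?_ rfl
  rintro x y ⟨b, hb⟩
  exact .single ⟨s b, by simp [hb]⟩

/-- Membership in a production tree whose letters are given by numbers is decidable as soon as
the membership of words in languages is. -/
theorem isRecursive_comap_productionTree {𝓛 : Set (Set X)} (φ : ℕ → X × Set X)
    (hφ : ∀ n, (φ n).2 ∈ 𝓛)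
    (hc : ComputablePred fun q : ℕ × ℕ => (φ q.1).1 ∈ (φ q.2).2) :
    ((productionTree 𝓛).comap φ).IsRecursive := by
  -- The default `0` is never used, since every position queried lies within the list.
  have hget : Computable fun q : List ℕ × ℕ => q.1.getD q.2 0 :=
    (Primrec.list_getD 0).to_comp
  have hp : ComputablePred fun q : (List ℕ × ℕ) × ℕ =>
      (φ (q.1.1.getD q.2 0)).1 ∈ (φ (q.1.1.getD q.1.2 0)).2 :=
    hc.comp ((hget.comp ((Computable.fst.comp Computable.fst).pair Computable.snd)).pair
      (hget.comp Computable.fst))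
  have hp' := (ComputablePred.forall_lt (p := fun (r : List ℕ × ℕ) k =>
      (φ (r.1.getD k 0)).1 ∈ (φ (r.1.getD r.2 0)).2) hp).comp
    (f := fun r : List ℕ × ℕ => (r, r.2 + 1))
    (Computable.id.pair (Computable.succ.comp Computable.snd))
  have h1 := (ComputablePred.forall_lt (p := fun (σ : List ℕ) i => ∀ k < i + 1,
      (φ (σ.getD k 0)).1 ∈ (φ (σ.getD i 0)).2) hp').comp
    (f := fun σ : List ℕ => (σ, σ.length)) (Computable.id.pair Computable.list_length)
  have hq : ComputablePred fun r : List ℕ × ℕ =>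
      ¬ (φ (r.1.getD (r.2 + 1) 0)).1 ∈ (φ (r.1.getD r.2 0)).2 :=
    (hc.comp ((hget.comp (Computable.fst.pair (Computable.succ.comp Computable.snd))).pair
      hget)).not
  -- Truncated subtraction is correct here: `j < length - 1` means `j + 1 < length`, also for the
  -- empty list.
  have h2 := (ComputablePred.forall_lt (p := fun (σ : List ℕ) i =>
      ¬ (φ (σ.getD (i + 1) 0)).1 ∈ (φ (σ.getD i 0)).2) hq).comp
    (f := fun σ : List ℕ => (σ, σ.length - 1))
    (Computable.id.pair (Primrec.pred.to_comp.comp Computable.list_length))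
  refine (h1.and h2).of_eq fun σ => ?_
  change _ ↔ IsProductionSeq 𝓛 (σ.map φ)
  simp only [IsProductionSeq, List.length_map, List.getElem_map, hφ, true_and]
  refine and_congr ?_ ?_
  · refine forall₂_congr fun i hi => forall_congr' fun k => ?_
    rw [Nat.lt_succ_iff]
    refine forall_congr' fun hk => ?_
    rw [List.getD_eq_getElem _ _ hi, List.getD_eq_getElem _ _ (lt_of_le_of_lt hk hi)]
  · refine forall_congr' fun j => ?_
    rw [Nat.lt_sub_iff_add_lt]
    refine forall_congr' fun hj => ?_
    rw [List.getD_eq_getElem _ _ hj, List.getD_eq_getElem _ _ (Nat.lt_of_succ_lt hj)]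

theorem IFRL.ν_mem_lang (F : IFRL X) (i : F.I) (j : F.J) :
    F.ν j ∈ F.lang i ↔ F.γ (i, j) = true := by
  constructor
  · rintro ⟨j', hj', h⟩
    rwa [F.ν_bijective.1 hj'] at h
  · exact fun h => ⟨j, rfl, h⟩

/-- The index sets of a family with a word and a language are recursively enumerable. -/
theorem IFRL.exists_enumeration (F : IFRL X) (i₀ : F.I) (j₀ : F.J) :
    ∃ f g : ℕ → ℕ, Computable f ∧ Computable g ∧ Set.range f = F.I ∧ Set.range g = F.J := by
  -- Fixing one argument of `γ` leaves a partial recursive function whose domain is the other index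
  -- set.
  have hI : REPred fun i => i ∈ F.I :=
    (F.γ_recursive.comp (Computable.id.pair (Computable.const (j₀ : ℕ)))).dom_re.of_eq
      fun i => by simp
  have hJ : REPred fun j => j ∈ F.J :=
    (F.γ_recursive.comp ((Computable.const (i₀ : ℕ)).pair Computable.id)).dom_re.of_eq
      fun j => by simp
  obtain ⟨f, hf, hf'⟩ := hI.exists_computable_range i₀.2
  obtain ⟨g, hg, hg'⟩ := hJ.exists_computable_range j₀.2
  exact ⟨f, g, hf, hg, hf', hg'⟩

theorem isRecursive_of_nodes_eq_singleton {T : SeqTree ℕ} (h : T.nodes = {[]}) :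
    T.IsRecursive := by
  refine ((PrimrecPred.computablePred
    (Primrec.eq.comp Primrec.id (Primrec.const ([] : List ℕ))))).of_eq fun σ => ?_
  simp [h]

theorem IFRL.isRecursiveOrdinal_rootRank (F : IFRL X)
    (hT : (productionTree F.setSystem).IsWellFounded) :
    IsRecursiveOrdinal hT.rootRank := by
  by_cases hne : Nonempty F.I ∧ Nonempty F.J
  · obtain ⟨⟨i₀⟩, ⟨j₀⟩⟩ := hne
    obtain ⟨f, g, hf, hg, hfI, hgJ⟩ := F.exists_enumeration i₀ j₀
    have hfm : ∀ n, f n ∈ F.I := fun n => hfI ▸ Set.mem_range_self n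
    have hgm : ∀ n, g n ∈ F.J := fun n => hgJ ▸ Set.mem_range_self n
    let φ : ℕ → X × Set X := fun n =>
      (F.ν ⟨g n.unpair.1, hgm _⟩, F.lang ⟨f n.unpair.2, hfm _⟩)
    have hφ : ∀ σ ∈ (productionTree F.setSystem).nodes, ∀ b ∈ σ, b ∈ Set.range φ := by
      rintro σ hσ ⟨x, L⟩ hb
      obtain ⟨⟨i, hi⟩, rfl : F.lang _ = L⟩ := mem_of_mem_productionSeq hσ hb
      obtain ⟨⟨j, hj⟩, rfl⟩ := F.ν_bijective.2 x
      obtain ⟨a, rfl⟩ := hfI.symm ▸ hi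
      obtain ⟨b, rfl⟩ := hgJ.symm ▸ hj
      exact ⟨Nat.pair b a, by simp [φ]⟩
    obtain ⟨h, heq⟩ := SeqTree.comap_rootRank φ hφ hT
    refine ⟨(productionTree F.setSystem).comap φ, h.rootRank,
      isRecursive_comap_productionTree φ (fun _ => Set.mem_range_self _) ?_, h,
      h.orderType_eq, by simpa using heq⟩
    have h1 : Computable fun q : ℕ × ℕ => (f q.2.unpair.2, g q.1.unpair.1) :=
      (hf.comp (Computable.snd.comp (Computable.unpair.comp Computable.snd))).pair
        (hg.comp (Computable.fst.comp (Computable.unpair.comp Computable.fst)))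
    have h2 : Computable fun q : ℕ × ℕ =>
        F.γ (⟨f q.2.unpair.2, hfm _⟩, ⟨g q.1.unpair.1, hgm _⟩) :=
      (F.γ_recursive.comp h1).of_eq_tot fun q => ⟨⟨hfm _, hgm _⟩, rfl⟩
    refine ComputablePred.computable_iff.2 ⟨_, h2, ?_⟩
    funext q
    exact propext (F.ν_mem_lang _ _)
  -- Without words or without languages only the empty sequence is a production sequence, and the
  -- dimension is that of a bare root.
  · have hnil : ∀ σ ∈ (productionTree F.setSystem).nodes, σ = [] := by
      refine fun σ hσ => List.eq_nil_iff_forall_not_mem.2 fun b hb => hne ?_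
      obtain ⟨i, _⟩ := mem_of_mem_productionSeq hσ hb
      obtain ⟨j, _⟩ := F.ν_bijective.2 b.1
      exact ⟨⟨i⟩, ⟨j⟩⟩
    let S : SeqTree ℕ := ⟨{[]}, rfl, by
      rintro σ τ rfl h
      exact List.prefix_nil.1 h⟩
    have hS : ∀ x y, ¬ S.Child x y := by
      rintro ⟨x, rfl⟩ y ⟨a, ha⟩
      simp at ha
    have hSw : S.IsWellFounded :=
      hT.of_map (fun _ => ⟨[], SeqTree.nil_mem _⟩) fun x y h => absurd h (hS x y)
    refine ⟨S, hSw.rootRank, isRecursive_of_nodes_eq_singleton rfl, hSw, hSw.orderType_eq, ?_⟩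
    have h1 := SeqTree.lift_rootRank_le hSw hT (fun _ => ⟨[], SeqTree.nil_mem _⟩)
      (fun x y h => absurd h (hS x y)) rfl
    have h2 := SeqTree.lift_rootRank_le hT hSw (fun _ => ⟨[], SeqTree.nil_mem _⟩)
      (by
        rintro x y ⟨b, hb⟩
        simp [hnil _ x.2] at hb) rfl
    simpa using le_antisymm h1 h2

end IndexTree

/-! ### The family of initial segments of a recursive tree. -/

namespace SeqTree

variable (T : SeqTree ℕ)

/-- The codes of the nodes of a tree other than the root. -/
def nonrootCodes : Set ℕ :=
  {n | Denumerable.ofNat (List ℕ) n ∈ T.nodes ∧ Denumerable.ofNat (List ℕ) n ≠ []}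

/-- The node with a given code. -/
def nodeOfCode (n : T.nonrootCodes) : T.nodes := ⟨Denumerable.ofNat (List ℕ) n, n.2.1⟩

theorem nodeOfCode_injective : Function.Injective T.nodeOfCode := fun _ _ h =>
  Subtype.ext ((Denumerable.eqv (List ℕ)).symm.injective (congrArg Subtype.val h))

theorem nodeOfCode_ne_nil (n : T.nonrootCodes) : (T.nodeOfCode n : List ℕ) ≠ [] := n.2.2

/-- The code of a node other than the root. -/
def codeOfNode (σ : List ℕ) (h : σ ∈ T.nodes) (hne : σ ≠ []) : T.nonrootCodes :=
  ⟨Encodable.encode σ, by simpa [nonrootCodes] using ⟨h, hne⟩⟩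

theorem nodeOfCode_codeOfNode {σ : List ℕ} (h : σ ∈ T.nodes) (hne : σ ≠ []) :
    (T.nodeOfCode (T.codeOfNode σ h hne) : List ℕ) = σ := by
  simp [nodeOfCode, codeOfNode]

theorem computablePred_nonrootCodes (hT : T.IsRecursive) :
    ComputablePred fun n : ℕ => n ∈ T.nonrootCodes :=
  (ComputablePred.comp hT (Computable.ofNat (List ℕ))).and
    (PrimrecPred.computablePred (Primrec.eq.comp (Primrec.ofNat (List ℕ)) (Primrec.const []))).not

theorem computable_prefix : Computable fun p : ℕ × ℕ =>
    decide (Denumerable.ofNat (List ℕ) p.2 <+: Denumerable.ofNat (List ℕ) p.1) := by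
  have h1 : Primrec fun p : ℕ × ℕ => Denumerable.ofNat (List ℕ) p.1 :=
    (Primrec.ofNat (List ℕ)).comp Primrec.fst
  have h2 : Primrec fun p : ℕ × ℕ => Denumerable.ofNat (List ℕ) p.2 :=
    (Primrec.ofNat (List ℕ)).comp Primrec.snd
  have h : PrimrecPred fun p : ℕ × ℕ =>
      Denumerable.ofNat (List ℕ) p.2 <+: Denumerable.ofNat (List ℕ) p.1 :=
    (Primrec.eq.comp h2 (Primrec.list_take.comp (Primrec.list_length.comp h2) h1)).of_eq
      fun p => List.prefix_iff_eq_take.symm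
  exact h.decide.to_comp

/-- The family whose words and languages are indexed by the nodes of `T` other than the root, the
language of a node consisting of its initial segments. -/
def initialSegmentFamily (hT : T.IsRecursive) : IFRL (ULift.{u} T.nonrootCodes) where
  I := T.nonrootCodes
  J := T.nonrootCodes
  ν := ULift.up
  ν_bijective := ULift.up_bijective
  γ p := decide ((T.nodeOfCode p.2 : List ℕ) <+: T.nodeOfCode p.1)
  γ_recursive := by
    obtain ⟨f, hf, hf'⟩ := ComputablePred.computable_iff.1
      (((T.computablePred_nonrootCodes hT).comp (Computable.fst (α := ℕ) (β := ℕ))).and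
        ((T.computablePred_nonrootCodes hT).comp (Computable.snd (α := ℕ) (β := ℕ))))
    -- The domain must be exactly `I × J`, so membership is tested first and the computation
    -- diverges outside.
    refine (Partrec.cond hf computable_prefix.partrec Partrec.none).of_eq fun p => ?_
    have hp := congrFun hf' p
    cases h : f p
    · simp only [h, Bool.false_eq_true, eq_iff_iff, iff_false] at hp
      exact (Part.eq_none_iff'.2 hp).symm
    · simp only [h, eq_iff_iff, iff_true] at hp
      symm
      rw [cond_true, PFun.coe_val, Part.eq_some_iff]
      exact ⟨hp, rfl⟩

variable {T} (hT : T.IsRecursive)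

theorem mem_lang_initialSegmentFamily (i : (T.initialSegmentFamily hT).I)
    (x : ULift.{u} T.nonrootCodes) :
    x ∈ (T.initialSegmentFamily hT).lang i ↔
      (T.nodeOfCode x.down : List ℕ) <+: T.nodeOfCode i :=
  ((T.initialSegmentFamily hT).ν_mem_lang i x.down).trans (by simp [initialSegmentFamily])

/-- Each node belongs to its own language, so nodes with equal languages are initial segments of
each other. -/
theorem initialSegmentFamily_withoutRepetition :
    (T.initialSegmentFamily.{u} hT).WithoutRepetition := by
  intro i j hij h
  have key : ∀ i j : T.nonrootCodes,
      (T.initialSegmentFamily.{u} hT).lang i = (T.initialSegmentFamily hT).lang j →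
      (T.nodeOfCode i : List ℕ) <+: T.nodeOfCode j := fun i j h =>
    (mem_lang_initialSegmentFamily hT j ⟨i⟩).1
      (h ▸ (mem_lang_initialSegmentFamily hT i ⟨i⟩).2 List.prefix_rfl)
  have h1 := key i j h
  exact hij (T.nodeOfCode_injective (Subtype.ext
    (h1.eq_of_length (h1.length_le.antisymm (key j i h.symm).length_le))))

/-- The node of the last word of a sequence, or the root. -/
def lastNode (s : List (ULift.{u} T.nonrootCodes × Set (ULift.{u} T.nonrootCodes))) : T.nodes :=
  (s.getLast?.map fun p => T.nodeOfCode p.1.down).getD ⟨[], T.nil_mem⟩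

/-- The last two words `q` and `p` are segments of the node of the last language, hence comparable.
The preceding language is closed under segments and contains `q` but not `p`, so `p` properly
extends `q`. -/
theorem transGen_child_lastNode
    (x y : (productionTree (T.initialSegmentFamily.{u} hT).setSystem).nodes)
    (h : (productionTree (T.initialSegmentFamily hT).setSystem).Child x y) :
    Relation.TransGen T.Child (lastNode (x : List _)) (lastNode (y : List _)) := by
  obtain ⟨x, hx⟩ := x
  obtain ⟨y, hy⟩ := y
  obtain ⟨p, rfl : x = y ++ [p]⟩ := h
  rcases List.eq_nil_or_concat y with rfl | ⟨z, q, rfl⟩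
  -- A first word lies properly below the root because the root is not a word.
  · exact transGen_child_of_prefix _ _ (List.nil_prefix) (T.nodeOfCode_ne_nil _).symm
  · obtain ⟨h1, h2⟩ := hx
    obtain ⟨⟨i, hi⟩, hpi⟩ := h1 (z.length + 1) (by simp)
    have hp := hpi (z.length + 1) le_rfl
    have hq := hpi z.length (by omega)
    obtain ⟨⟨j, hj⟩, hqj⟩ := h1 z.length (by simp)
    have hqq := hqj z.length le_rfl
    have hpq := h2 z.length (by simp)
    rw [← hi] at hp hq
    rw [← hj] at hqq hpq
    rw [mem_lang_initialSegmentFamily] at hp hq hqq hpq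
    simp only [List.getElem_append] at hp hq hqq hpq
    simp at hp hq hqq hpq
    have hne : (T.nodeOfCode q.1.down : List ℕ) ≠ T.nodeOfCode p.1.down := fun h =>
      hpq (h ▸ hqq)
    simp only [lastNode, List.getLast?_append, List.getLast?_singleton, List.concat_eq_append]
    refine transGen_child_of_prefix _ _ ?_ hne
    rcases List.prefix_or_prefix_of_prefix hq hp with h | h
    · exact h
    · exact absurd (h.trans hqq) hpq

/-- The words and languages of the nonempty initial segments of a node. -/
def segmentSeq (σ : T.nodes) :
    List (ULift.{u} T.nonrootCodes × Set (ULift.{u} T.nonrootCodes)) :=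
  List.ofFn fun k : Fin (σ : List ℕ).length =>
    let c := T.codeOfNode ((σ : List ℕ).take (k + 1))
      (T.mem_of_prefix σ.2 (List.take_prefix _ _)) (by
        have := k.2
        intro h
        rw [List.take_eq_nil_iff] at h
        grind)
    (⟨c⟩, (T.initialSegmentFamily hT).lang c)

theorem segmentSeq_mem (σ : T.nodes) :
    segmentSeq.{u} hT σ ∈ (productionTree (T.initialSegmentFamily.{u} hT).setSystem).nodes := by
  refine ⟨fun i hi => ⟨?_, fun k hk => ?_⟩, fun j hj => ?_⟩
  · simp only [segmentSeq, List.getElem_ofFn]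
    exact Set.mem_range_self _
  · simp only [segmentSeq, List.getElem_ofFn]
    refine (mem_lang_initialSegmentFamily hT _ _).2 ?_
    simp only [nodeOfCode_codeOfNode]
    exact List.take_prefix_take_left (by omega)
  · simp only [segmentSeq, List.length_ofFn] at hj
    simp only [segmentSeq, List.getElem_ofFn]
    refine fun hmem => ?_
    have h := (mem_lang_initialSegmentFamily hT _ _).1 hmem
    simp only [nodeOfCode_codeOfNode] at h
    -- A segment of length `j + 2` would be a prefix of one of length `j + 1`.
    have := h.length_le
    simp only [List.length_take] at this
    omega

theorem segmentSeq_child (x y : T.nodes) (h : T.Child x y) :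
    (productionTree (T.initialSegmentFamily.{u} hT).setSystem).Child
      ⟨segmentSeq hT x, segmentSeq_mem hT x⟩ ⟨segmentSeq hT y, segmentSeq_mem hT y⟩ := by
  obtain ⟨x, hx⟩ := x
  obtain ⟨a, rfl : x = y ++ [a]⟩ := h
  refine ⟨(segmentSeq.{u} hT ⟨y ++ [a], hx⟩)[(y : List ℕ).length]'(by simp [segmentSeq]), ?_⟩
  apply List.ext_getElem
  · simp [segmentSeq]
  · intro i h1 h2
    rw [List.getElem_append]
    -- Segments of length at most that of `y` are unaffected by the appended letter; the only new
    -- entry is the last.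
    split
    · rename_i h
      replace h : i + 1 ≤ (y : List ℕ).length := by simpa [segmentSeq] using h
      simp only [segmentSeq, List.getElem_ofFn, List.take_append_of_le_length h]
    · rename_i h
      replace h : ¬ i < (y : List ℕ).length := by simpa [segmentSeq] using h
      replace h1 : i < (y : List ℕ).length + 1 := by simpa [segmentSeq] using h1
      obtain rfl : i = (y : List ℕ).length := by omega
      simp

theorem dim_initialSegmentFamily (hw : T.IsWellFounded) :
    (T.initialSegmentFamily.{u} hT).dim =
      (Ordinal.lift.{u} hw.rootRank : WithTop Ordinal.{u}) := by
  have h := hw.of_map _ (transGen_child_lastNode.{u} hT)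
  have h1 := lift_rootRank_le h hw _ (transGen_child_lastNode hT) rfl
  have h2 := lift_rootRank_le hw h _ (fun x y hxy => .single (segmentSeq_child hT x y hxy)) rfl
  rw [IFRL.dim, setSystemDim, h.orderType_eq]
  simpa using le_antisymm h1 h2

end SeqTree

theorem theorem1 :
    (∀ (X : Type u) (F : IFRL X), F.WithoutRepetition → HasFiniteElasticity F.setSystem →
      ∃ α : Ordinal.{u}, IsRecursiveOrdinal α ∧ F.dim = (α : WithTop Ordinal.{u})) ∧
    (∀ α : Ordinal.{u}, IsRecursiveOrdinal α →
      ∃ (X : Type u) (F : IFRL X), F.WithoutRepetition ∧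
        (ComputablePred fun i : ℕ => i ∈ F.I) ∧ (ComputablePred fun j : ℕ => j ∈ F.J) ∧
        F.dim = (α : WithTop Ordinal.{u})) := by
  refine ⟨fun X F _ hF => ?_, ?_⟩
  · exact ⟨_, F.isRecursiveOrdinal_rootRank hF.isWellFounded, hF.isWellFounded.orderType_eq⟩
  · rintro _ ⟨T, β, hT, hw, hβ, rfl⟩
    rw [hw.orderType_eq, WithTop.coe_inj] at hβ
    subst hβ
    exact ⟨_, T.initialSegmentFamily hT, SeqTree.initialSegmentFamily_withoutRepetition hT,
      T.computablePred_nonrootCodes hT, T.computablePred_nonrootCodes hT,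
      SeqTree.dim_initialSegmentFamily hT hw⟩
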